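/- Let $N_{\mathbb C}(0,1)$ denote the law of a complex random variable whose real and imaginary parts are independent centred Gaussians of variance $\tfrac12$, and let $\mathrm{GUE}(2)$ be the law of the Hermitian random matrix $\tfrac12(Z+Z^\dagger)$, where $Z$ is a $2\times2$ matrix with i.i.d. $N_{\mathbb C}(0,1)$ entries (so its density is proportional to $e^{-\operatorname{Tr}A^2}$). Let $A$ and $B$ be independent random matrices with law $\mathrm{GUE}(2)$. Then the joint law of the eigenvalues $c=(c_1,c_2)$ of $A+B$, listed in uniformly random order (that is, symmetrized over permutations), has density with respect to Lebesgue measure on $\mathbb{R}^2$ given by $$p_{A+B}(c)=\frac1{4\pi}(c_1-c_2)^2\exp\left(-\frac{c_1^2+c_2^2}{2}\right),\qquad (c_1,c_2)\in\mathbb{R}^2 .$$ Correspondingly, the vector of eigenvalues of $A+B$ listed in non-increasing order has density $2\,p_{A+B}(c)$ on $\{c_1\ge c_2\}$ (and $0$ elsewhere). -/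

import Mathlib

open MeasureTheory ProbabilityTheory
open scoped NNReal ENNReal Nat Matrix

/-- The product (entrywise) σ-algebra on matrices with complex entries. -/
noncomputable instance complexMatrixMeasurableSpace (n : ℕ) : MeasurableSpace (Matrix (Fin n) (Fin n) ℂ) :=
  MeasurableSpace.pi (X := fun _ : Fin n => Fin n → ℂ)

/-- The standard complex normal law `N_ℂ(0,1)`: real and imaginary parts are independent
centred Gaussians of variance `1/2`. -/
noncomputable def stdComplexGaussian : Measure ℂ :=
  ((gaussianReal 0 (1 / 2)).prod (gaussianReal 0 (1 / 2))).map (fun p : ℝ × ℝ => (⟨p.1, p.2⟩ : ℂ))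

/-- The law of an `n × n` matrix whose entries are i.i.d. standard complex normal. -/
noncomputable def complexGinibre (n : ℕ) : Measure (Matrix (Fin n) (Fin n) ℂ) :=
  Measure.pi (fun _ : Fin n => Measure.pi (fun _ : Fin n => stdComplexGaussian))

/-- The law `GUE(n)`: the law of `(Z + Z†) / 2`, where `Z` has i.i.d. standard complex normal
entries. -/
noncomputable def gue (n : ℕ) : Measure (Matrix (Fin n) (Fin n) ℂ) :=
  (complexGinibre n).map (fun Z => (1 / 2 : ℂ) • (Z + Zᴴ))

open Classical in
/-- The eigenvalues of a Hermitian matrix, with multiplicity, in non-increasing order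
(the zero vector if the matrix is not Hermitian). -/
noncomputable def orderedEigenvalues {n : ℕ} (X : Matrix (Fin n) (Fin n) ℂ) : Fin n → ℝ :=
  if h : X.IsHermitian then fun i => h.eigenvalues₀ (Fin.cast (Fintype.card_fin n).symm i) else 0

/-- The joint law of the eigenvalues of the random matrix `X` as a permutation-invariant measure
on `ℝⁿ`: the eigenvalues are listed in a uniformly random order, that is, the law of the ordered
eigenvalue vector is averaged over all permutations of the coordinates. -/
noncomputable def eigenvalueLaw {Ω : Type*} [MeasurableSpace Ω] {n : ℕ} (P : Measure Ω)
    (X : Ω → Matrix (Fin n) (Fin n) ℂ) : Measure (Fin n → ℝ) :=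
  ((n ! : ℝ≥0∞))⁻¹ •
    ∑ σ : Equiv.Perm (Fin n), P.map (fun ω i => orderedEigenvalues (X ω) (σ i))

theorem measurable_complex_mk : Measurable (fun p : ℝ × ℝ => (⟨p.1, p.2⟩ : ℂ)) :=
  Complex.measurableEquivRealProd.symm.measurable

instance isProbabilityMeasure_stdComplexGaussian : IsProbabilityMeasure stdComplexGaussian :=
  Measure.isProbabilityMeasure_map measurable_complex_mk.aemeasurable

instance isProbabilityMeasure_complexGinibre (n : ℕ) : IsProbabilityMeasure (complexGinibre n) :=
  inferInstanceAs (IsProbabilityMeasure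
    (Measure.pi (fun _ : Fin n => Measure.pi (fun _ : Fin n => stdComplexGaussian))))

theorem measurable_hermitianPart (n : ℕ) :
    Measurable (fun Z : Matrix (Fin n) (Fin n) ℂ => (1 / 2 : ℂ) • (Z + Zᴴ)) := by
  have hent : ∀ i j, Measurable (fun Z : Matrix (Fin n) (Fin n) ℂ => Z i j) := fun i j =>
    (measurable_pi_apply j).comp (measurable_pi_apply (X := fun _ : Fin n => Fin n → ℂ) i)
  refine measurable_pi_lambda (X := fun _ : Fin n => Fin n → ℂ) _ fun i =>
    measurable_pi_lambda _ fun j => ?_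
  exact ((hent i j).add (Complex.continuous_conj.measurable.comp (hent j i))).const_mul (1 / 2 : ℂ)

instance isProbabilityMeasure_gue (n : ℕ) : IsProbabilityMeasure (gue n) :=
  Measure.isProbabilityMeasure_map (measurable_hermitianPart n).aemeasurable

theorem orderedEigenvalues_antitone {n : ℕ} (X : Matrix (Fin n) (Fin n) ℂ) :
    Antitone (orderedEigenvalues X) := by
  unfold orderedEigenvalues
  split_ifs with h
  · exact fun i j hij => h.eigenvalues₀_antitone (by simpa using hij)
  · exact antitone_const

/-! A `2 × 2` Hermitian matrix is `m I + v · σ` with `m` real, `v ∈ ℝ³` and `σ` the Pauli matrices,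
and its eigenvalues are `m ± ‖v‖` (`orderedEigenvalues_eq_of_isHermitian`). The coordinates `(m, v)`
are linear in the matrix, and under GUE(2) they form an isotropic Gaussian on `ℝ⁴` of variance `1/4`
(`charFun_map_pauliCoord_gue`). For `A + B` the variance doubles, so `m` and `v` are independent
with densities `π^(-1/2) e^(-m²)` and `π^(-3/2) e^(-‖v‖²)` (`map_pauliCoord_add`).

Polar coordinates in `ℝ³` give `(m, r)`, with `r = ‖v‖`, the density `(4/π) r² e^(-m²-r²)` on `r ≥
0`. Setting `c = (m + r, m - r)`, one has `r = (c₀ - c₁)/2`, `m² + r² = (c₀² + c₁²)/2` and Jacobian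
`2`, which yields the ordered density (`map_add_sub_norm_gaussian`). The factor `(c₀ - c₁)²` is thus
the area growth of spheres in `ℝ³`. The unordered law follows by symmetrization. -/

/-! ### Pauli coordinates and eigenvalues. -/

/-- Half the trace of a `2 × 2` Hermitian matrix. -/
noncomputable def halfTrace (X : Matrix (Fin 2) (Fin 2) ℂ) : ℝ :=
  ((X 0 0).re + (X 1 1).re) / 2

/-- The coordinates of the traceless part of a `2 × 2` Hermitian matrix in the Pauli basis. -/
noncomputable def blochVector (X : Matrix (Fin 2) (Fin 2) ℂ) : EuclideanSpace ℝ (Fin 3) :=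
  !₂[((X 0 0).re - (X 1 1).re) / 2, (X 0 1).re, (X 0 1).im]

theorem norm_sq_blochVector (X : Matrix (Fin 2) (Fin 2) ℂ) :
    ‖blochVector X‖ ^ 2 =
      (((X 0 0).re - (X 1 1).re) / 2) ^ 2 + (X 0 1).re ^ 2 + (X 0 1).im ^ 2 := by
  rw [EuclideanSpace.norm_sq_eq, Fin.sum_univ_three]
  simp [blochVector, div_pow]

theorem measurable_matrix_entry {n : ℕ} (i j : Fin n) :
    Measurable (fun Z : Matrix (Fin n) (Fin n) ℂ => Z i j) :=
  (measurable_pi_apply j).comp (measurable_pi_apply (X := fun _ : Fin n => Fin n → ℂ) i)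

theorem measurable_halfTrace : Measurable halfTrace :=
  ((Complex.measurable_re.comp (measurable_matrix_entry 0 0)).add
    (Complex.measurable_re.comp (measurable_matrix_entry 1 1))).div_const 2

theorem measurable_blochVector : Measurable blochVector := by
  refine (MeasurableEquiv.toLp 2 (Fin 3 → ℝ)).measurable.comp (measurable_pi_lambda _ fun i => ?_)
  fin_cases i
  · exact ((Complex.measurable_re.comp (measurable_matrix_entry 0 0)).sub
      (Complex.measurable_re.comp (measurable_matrix_entry 1 1))).div_const 2
  · exact Complex.measurable_re.comp (measurable_matrix_entry 0 1)
  · exact Complex.measurable_im.comp (measurable_matrix_entry 0 1)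

/-- Trace and determinant fix the sum and product of the eigenvalues `a ≥ b`. Since `‖v‖² = (tr/2)²
- det = ((a - b)/2)²`, the ordering selects the root `‖v‖ = (a - b)/2`. -/
theorem orderedEigenvalues_eq_of_isHermitian {X : Matrix (Fin 2) (Fin 2) ℂ}
    (hX : X.IsHermitian) :
    orderedEigenvalues X = ![halfTrace X + ‖blochVector X‖, halfTrace X - ‖blochVector X‖] := by
  have hanti : orderedEigenvalues X 1 ≤ orderedEigenvalues X 0 :=
    orderedEigenvalues_antitone X (by decide)
  -- `eigenvalues` reindexes `eigenvalues₀` by an arbitrary equivalence. Which one is irrelevant,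
  -- since only the sum and the product are used.
  have hev : ∃ σ : Equiv.Perm (Fin 2), ∀ i, hX.eigenvalues i = orderedEigenvalues X (σ i) := by
    refine ⟨(Fintype.equivOfCardEq (Fintype.card_fin _)).symm.trans
      (finCongr (Fintype.card_fin 2)), fun i => ?_⟩
    simp only [orderedEigenvalues, dif_pos hX, Matrix.IsHermitian.eigenvalues]
    rfl
  obtain ⟨σ, hσ⟩ := hev
  have htr : X 0 0 + X 1 1 = ((orderedEigenvalues X 0 + orderedEigenvalues X 1 : ℝ) : ℂ) := by
    have := hX.trace_eq_sum_eigenvalues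
    rw [Matrix.trace_fin_two] at this
    rw [this]
    simp only [hσ]
    rw [Equiv.sum_comp σ (fun i => (RCLike.ofReal (orderedEigenvalues X i) : ℂ)),
      Fin.sum_univ_two]
    simp
  have hdet : X 0 0 * X 1 1 - X 0 1 * X 1 0
      = ((orderedEigenvalues X 0 * orderedEigenvalues X 1 : ℝ) : ℂ) := by
    have := hX.det_eq_prod_eigenvalues
    rw [Matrix.det_fin_two] at this
    rw [this]
    simp only [hσ]
    rw [Equiv.prod_comp σ (fun i => (RCLike.ofReal (orderedEigenvalues X i) : ℂ)),
      Fin.prod_univ_two]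
    simp
  have him : ∀ i, (X i i).im = 0 := fun i => Complex.conj_eq_iff_im.1 (hX.apply i i)
  have h10 : X 1 0 = star (X 0 1) := (hX.apply 1 0).symm
  rw [h10] at hdet
  have htr' := congrArg Complex.re htr
  have hdet' := congrArg Complex.re hdet
  simp [him] at htr' hdet'
  have hn := norm_sq_blochVector X
  set a := orderedEigenvalues X 0
  set b := orderedEigenvalues X 1
  have hhalf : halfTrace X = (a + b) / 2 := by rw [halfTrace, htr']
  have hr : ‖blochVector X‖ = (a - b) / 2 := by
    rw [← sq_eq_sq₀ (norm_nonneg _) (by linarith), hn]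
    linear_combination ((X 0 0).re + (X 1 1).re + a + b) / 4 * htr' - hdet'
  ext i
  fin_cases i
  · change a = halfTrace X + ‖blochVector X‖
    rw [hhalf, hr]; ring
  · change b = halfTrace X - ‖blochVector X‖
    rw [hhalf, hr]; ring

/-! ### Characteristic functions of the Gaussian matrix ensembles. -/

theorem charFun_stdComplexGaussian (a b : ℝ) :
    ∫ z, Complex.exp (((a * z.re + b * z.im : ℝ) : ℂ) * Complex.I) ∂stdComplexGaussian =
      Complex.exp (-((a ^ 2 + b ^ 2 : ℝ) : ℂ) / 4) := by
  have h1 : ∀ t : ℝ, ∫ x : ℝ, Complex.exp (t * x * Complex.I) ∂gaussianReal 0 (1 / 2) =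
      Complex.exp (-(t : ℂ) ^ 2 / 4) := by
    intro t
    rw [← charFun_apply_real, charFun_gaussianReal]
    congr 1
    push_cast
    ring
  rw [stdComplexGaussian, integral_map measurable_complex_mk.aemeasurable (by fun_prop)]
  have h2 : ∀ p : ℝ × ℝ, Complex.exp (((a * p.1 + b * p.2 : ℝ) : ℂ) * Complex.I) =
      Complex.exp (a * p.1 * Complex.I) * Complex.exp (b * p.2 * Complex.I) := by
    intro p
    rw [← Complex.exp_add]
    push_cast
    ring_nf
  simp only [h2]
  rw [integral_prod_mul (fun x : ℝ => Complex.exp (a * x * Complex.I))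
    (fun x : ℝ => Complex.exp (b * x * Complex.I)), h1, h1, ← Complex.exp_add]
  push_cast
  ring_nf

theorem charFun_complexGinibre {n : ℕ} (a b : Fin n → Fin n → ℝ) :
    ∫ Z, Complex.exp
      (((∑ i, ∑ j, (a i j * (Z i j).re + b i j * (Z i j).im) : ℝ) : ℂ) * Complex.I)
        ∂complexGinibre n =
      Complex.exp (-((∑ i, ∑ j, (a i j ^ 2 + b i j ^ 2) : ℝ) : ℂ) / 4) := by
  have h : ∀ Z : Fin n → Fin n → ℂ, Complex.exp
      (((∑ i, ∑ j, (a i j * (Z i j).re + b i j * (Z i j).im) : ℝ) : ℂ) * Complex.I) =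
      ∏ i, ∏ j, Complex.exp
        (((a i j * (Z i j).re + b i j * (Z i j).im : ℝ) : ℂ) * Complex.I) := by
    intro Z
    simp_rw [← Complex.exp_sum, Complex.ofReal_sum, Finset.sum_mul]
  change ∫ Z : Fin n → Fin n → ℂ, _ ∂(Measure.pi fun _ : Fin n => Measure.pi
    fun _ : Fin n => stdComplexGaussian) = _
  simp_rw [h]
  rw [integral_fintype_prod_eq_prod (fun (i : Fin n) (z : Fin n → ℂ) => ∏ j, Complex.exp
        (((a i j * (z j).re + b i j * (z j).im : ℝ) : ℂ) * Complex.I))]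
  have h2 : ∀ i, ∫ z : Fin n → ℂ, ∏ j, Complex.exp
        (((a i j * (z j).re + b i j * (z j).im : ℝ) : ℂ) * Complex.I)
          ∂(Measure.pi fun _ : Fin n => stdComplexGaussian) =
      ∏ j, Complex.exp (-((a i j ^ 2 + b i j ^ 2 : ℝ) : ℂ) / 4) := by
    intro i
    rw [integral_fintype_prod_eq_prod (fun (j : Fin n) (z : ℂ) => Complex.exp
        (((a i j * z.re + b i j * z.im : ℝ) : ℂ) * Complex.I))]
    simp_rw [charFun_stdComplexGaussian]
  simp_rw [h2, ← Complex.exp_sum]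
  push_cast
  simp_rw [neg_div, Finset.sum_neg_distrib, Finset.sum_div]

/-- The coordinates of a `2 × 2` Hermitian matrix, in the Euclidean space `ℝ × ℝ³`. -/
noncomputable def pauliCoord (X : Matrix (Fin 2) (Fin 2) ℂ) :
    WithLp 2 (ℝ × EuclideanSpace ℝ (Fin 3)) :=
  WithLp.toLp 2 (halfTrace X, blochVector X)

theorem measurable_pauliCoord : Measurable pauliCoord :=
  (MeasurableEquiv.toLp 2 (ℝ × EuclideanSpace ℝ (Fin 3))).measurable.comp
    (measurable_halfTrace.prodMk measurable_blochVector)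

theorem pauliCoord_add (X Y : Matrix (Fin 2) (Fin 2) ℂ) :
    pauliCoord (X + Y) = pauliCoord X + pauliCoord Y := by
  have h1 : halfTrace (X + Y) = halfTrace X + halfTrace Y := by
    simp only [halfTrace, Matrix.add_apply, Complex.add_re]; ring
  have h2 : blochVector (X + Y) = blochVector X + blochVector Y := by
    ext i
    fin_cases i
    · simp [blochVector]; ring
    · simp [blochVector]
    · simp [blochVector]
  rw [pauliCoord, h1, h2]
  rfl

theorem charFun_map_pauliCoord_gue (t : WithLp 2 (ℝ × EuclideanSpace ℝ (Fin 3))) :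
    charFun ((gue 2).map pauliCoord) t = Complex.exp (-((‖t‖ ^ 2 : ℝ) : ℂ) / 8) := by
  rw [charFun_apply, gue, Measure.map_map measurable_pauliCoord (measurable_hermitianPart 2),
    integral_map (measurable_pauliCoord.comp (measurable_hermitianPart 2)).aemeasurable
      (by fun_prop)]
  set s := t.fst
  set v := t.snd
  -- These are the coefficients of `Re Z i j` and `Im Z i j` in the pairing of `t` with the
  -- coordinates of `(Z + Z†)/2`. Their squares add up to `‖t‖²/2`, whence the `8`.
  have h := charFun_complexGinibre
    (fun i j : Fin 2 => !![(s + v 0) / 2, v 1 / 2; v 1 / 2, (s - v 0) / 2] i j)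
    (fun i j : Fin 2 => !![0, v 2 / 2; -(v 2 / 2), 0] i j)
  convert! h using 1
  · refine integral_congr_ae (.of_forall fun Z => ?_)
    simp only [Function.comp]
    congr 3
    rw [WithLp.prod_inner_apply]
    simp [pauliCoord, halfTrace, blochVector, PiLp.inner_apply, Fin.sum_univ_three]
    ring
  · have hs : ‖t‖ ^ 2 = s ^ 2 + (v 0 ^ 2 + v 1 ^ 2 + v 2 ^ 2) := by
      rw [WithLp.prod_norm_sq_eq_of_L2, EuclideanSpace.norm_sq_eq]
      simp [Fin.sum_univ_three, s, v]
    rw [hs]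
    simp [Fin.sum_univ_two]
    ring_nf

/-! ### The Gaussian on `ℝ³` and the joint law of the coordinates of `A + B`. -/

/-- The centred Gaussian law on `ℝ³` with covariance `1 / 2`. -/
noncomputable def gaussianThree : Measure (EuclideanSpace ℝ (Fin 3)) :=
  volume.withDensity fun v => ENNReal.ofReal ((√Real.pi ^ 3)⁻¹ * Real.exp (-‖v‖ ^ 2))

theorem pi_cpow_three_div_two : (Real.pi : ℂ) ^ (3 / 2 : ℂ) = ((√Real.pi ^ 3 : ℝ) : ℂ) := by
  rw [Real.sqrt_eq_rpow, ← Real.rpow_natCast, ← Real.rpow_mul Real.pi_pos.le,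
    Complex.ofReal_cpow Real.pi_pos.le]
  norm_num

theorem charFun_gaussianThree (t : EuclideanSpace ℝ (Fin 3)) :
    charFun gaussianThree t = Complex.exp (-((‖t‖ ^ 2 : ℝ) : ℂ) / 4) := by
  have h := GaussianFourier.integral_cexp_neg_mul_sq_norm_add (b := 1) (by simp) Complex.I t
  have hπ : (√Real.pi ^ 3 : ℝ) ≠ 0 := by positivity
  rw [charFun_apply, gaussianThree, integral_withDensity_eq_integral_toReal_smul (by fun_prop)
    (.of_forall fun _ => ENNReal.ofReal_lt_top)]
  have h2 : ∀ v : EuclideanSpace ℝ (Fin 3),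
      (ENNReal.ofReal ((√Real.pi ^ 3)⁻¹ * Real.exp (-‖v‖ ^ 2))).toReal •
        Complex.exp ((inner ℝ v t : ℝ) * Complex.I) =
      ((√Real.pi ^ 3)⁻¹ : ℝ) *
        Complex.exp (-1 * ‖v‖ ^ 2 + Complex.I * (inner ℝ t v : ℝ)) := by
    intro v
    rw [ENNReal.toReal_ofReal (by positivity), Complex.real_smul, Complex.ofReal_mul,
      Complex.ofReal_exp, mul_assoc, ← Complex.exp_add, real_inner_comm]
    push_cast
    ring_nf
  simp_rw [h2]
  rw [integral_const_mul, h, finrank_euclideanSpace, Fintype.card_fin]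
  have h3 : ((Real.pi : ℂ) / 1) ^ (((3 : ℕ) : ℂ) / 2) = ((√Real.pi ^ 3 : ℝ) : ℂ) := by
    rw [div_one, Nat.cast_ofNat, pi_cpow_three_div_two]
  rw [h3, ← mul_assoc, ← Complex.ofReal_mul, inv_mul_cancel₀ hπ]
  simp [neg_div]

instance isFiniteMeasure_gaussianThree : IsFiniteMeasure gaussianThree := by
  refine isFiniteMeasure_withDensity_ofReal (Integrable.hasFiniteIntegral ?_)
  have h := GaussianFourier.integrable_cexp_neg_mul_sq_norm_add (b := 1) (by simp) 0
    (0 : EuclideanSpace ℝ (Fin 3))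
  have h2 := h.re.const_mul (√Real.pi ^ 3)⁻¹
  refine h2.congr (.of_forall fun v => ?_)
  have : (-1 * (‖v‖ : ℂ) ^ 2 + 0 * ((inner ℝ (0 : EuclideanSpace ℝ (Fin 3)) v : ℝ) : ℂ)) =
    ((-‖v‖ ^ 2 : ℝ) : ℂ) := by push_cast; ring
  simp only [this]
  rw [← Complex.ofReal_exp]
  rfl

/-- By independence the characteristic functions multiply, giving `exp (-‖t‖²/4)`. This factors over
`ℝ` and `ℝ³`, and a finite measure is determined by its characteristic function. -/
theorem map_pauliCoord_add {Ω : Type*} [MeasurableSpace Ω] {P : Measure Ω}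
    [IsProbabilityMeasure P] {A B : Ω → Matrix (Fin 2) (Fin 2) ℂ} (hA : HasLaw A (gue 2) P)
    (hB : HasLaw B (gue 2) P) (hAB : IndepFun A B P) :
    P.map (fun ω => (halfTrace (A ω + B ω), blochVector (A ω + B ω))) =
      (gaussianReal 0 (1 / 2)).prod gaussianThree := by
  have hpA := measurable_pauliCoord.comp_aemeasurable hA.aemeasurable
  have hpB := measurable_pauliCoord.comp_aemeasurable hB.aemeasurable
  have hchar : ∀ {X : Ω → Matrix (Fin 2) (Fin 2) ℂ}, HasLaw X (gue 2) P →
      ∀ t, charFun (P.map (pauliCoord ∘ X)) t = Complex.exp (-((‖t‖ ^ 2 : ℝ) : ℂ) / 8) := by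
    intro X hX t
    rw [← AEMeasurable.map_map_of_aemeasurable measurable_pauliCoord.aemeasurable hX.aemeasurable,
      hX.map_eq, charFun_map_pauliCoord_gue]
  have hsum : P.map (fun ω => pauliCoord (A ω + B ω)) =
      P.map (pauliCoord ∘ A + pauliCoord ∘ B) :=
    congrArg P.map (funext fun ω => pauliCoord_add (A ω) (B ω))
  have hmap : (P.map (fun ω => (halfTrace (A ω + B ω), blochVector (A ω + B ω)))).map
      (WithLp.toLp 2) = P.map (fun ω => pauliCoord (A ω + B ω)) := by
    rw [AEMeasurable.map_map_of_aemeasurable]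
    · rfl
    · exact (MeasurableEquiv.toLp 2 (ℝ × EuclideanSpace ℝ (Fin 3))).measurable.aemeasurable
    · have : AEMeasurable (fun ω => pauliCoord (A ω + B ω)) P := by
        simp_rw [pauliCoord_add]
        exact hpA.add hpB
      exact (MeasurableEquiv.toLp 2 (ℝ × EuclideanSpace ℝ (Fin 3))).symm.measurable.comp_aemeasurable
        this
  refine charFun_eq_prod_iff.1 fun t => ?_
  rw [hmap, hsum, (hAB.comp measurable_pauliCoord measurable_pauliCoord).charFun_map_add_eq_mul
    hpA hpB, Pi.mul_apply, hchar hA, hchar hB, charFun_gaussianReal, charFun_gaussianThree,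
    ← Complex.exp_add, ← Complex.exp_add, WithLp.prod_norm_sq_eq_of_L2]
  congr 1
  simp
  ring

theorem isHermitian_ae_gue (n : ℕ) : ∀ᵐ X ∂gue n, X.IsHermitian := by
  have hmeas : MeasurableSet {X : Matrix (Fin n) (Fin n) ℂ | X.IsHermitian} := by
    have : {X : Matrix (Fin n) (Fin n) ℂ | X.IsHermitian} =
        ⋂ i, ⋂ j, {X | star (X j i) = X i j} := by
      ext X
      simp [Matrix.IsHermitian, ← Matrix.ext_iff]
    rw [this]
    exact .iInter fun i => .iInter fun j => measurableSet_eq_fun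
      (Complex.continuous_conj.measurable.comp (measurable_matrix_entry j i))
      (measurable_matrix_entry i j)
  rw [gue, ae_map_iff (measurable_hermitianPart n).aemeasurable hmeas]
  refine .of_forall fun Z => ?_
  rw [Matrix.IsHermitian, Matrix.conjTranspose_smul, Matrix.conjTranspose_add,
    Matrix.conjTranspose_conjTranspose, add_comm Zᴴ]
  simp

/-! ### Polar coordinates and change of variables. -/

theorem lintegral_fun_norm_euclideanSpace_three {f : ℝ → ℝ≥0∞} (hf : Measurable f) :
    ∫⁻ v : EuclideanSpace ℝ (Fin 3), f ‖v‖ =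
      ∫⁻ r in Set.Ioi (0 : ℝ), ENNReal.ofReal (4 * Real.pi * r ^ 2) * f r := by
  have hmp := (volume : Measure (EuclideanSpace ℝ (Fin 3))).measurePreserving_homeomorphUnitSphereProd
  calc ∫⁻ v : EuclideanSpace ℝ (Fin 3), f ‖v‖
      = ∫⁻ v : ({(0)}ᶜ : Set (EuclideanSpace ℝ (Fin 3))), f ‖v.1‖
          ∂((volume : Measure (EuclideanSpace ℝ (Fin 3))).comap (↑)) := by
        rw [lintegral_subtype_comap (measurableSet_singleton _).compl
          fun v : EuclideanSpace ℝ (Fin 3) => f ‖v‖, restrict_compl_singleton]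
    _ = ∫⁻ x, f x.2 ∂((volume : Measure (EuclideanSpace ℝ (Fin 3))).toSphere.prod
          (.volumeIoiPow (Module.finrank ℝ (EuclideanSpace ℝ (Fin 3)) - 1))) := by
        simpa using hmp.lintegral_comp_emb (Homeomorph.measurableEmbedding _)
          (f ∘ Subtype.val ∘ Prod.snd)
    _ = ENNReal.ofReal (4 * Real.pi) *
          ∫⁻ r : Set.Ioi (0 : ℝ), f r ∂(Measure.volumeIoiPow 2) := by
        rw [finrank_euclideanSpace, Fintype.card_fin]
        have h := lintegral_prod_mul
          (μ := (volume : Measure (EuclideanSpace ℝ (Fin 3))).toSphere)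
          (ν := Measure.volumeIoiPow 2) (f := fun _ => 1) (g := fun r => f r) (by fun_prop)
          (by fun_prop)
        simp only [one_mul, lintegral_one] at h
        -- The area of the unit sphere is the dimension times the volume of the unit ball: `3 ·
        -- (4π/3) = 4π`.
        rw [h, Measure.toSphere_apply_univ, EuclideanSpace.volume_ball_fin_three,
          finrank_euclideanSpace, Fintype.card_fin]
        congr 1
        rw [ENNReal.ofReal_one, one_pow, one_mul, ← ENNReal.ofReal_natCast,
          ← ENNReal.ofReal_mul (by positivity)]
        congr 1
        push_cast
        ring
    _ = _ := by
        rw [Measure.volumeIoiPow, lintegral_withDensity_eq_lintegral_mul _ (by fun_prop)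
          (by fun_prop)]
        simp only [Pi.mul_apply]
        rw [lintegral_subtype_comap measurableSet_Ioi fun r : ℝ => ENNReal.ofReal (r ^ 2) * f r,
          ← lintegral_const_mul _ (by fun_prop)]
        refine lintegral_congr fun r => ?_
        rw [← mul_assoc, ← ENNReal.ofReal_mul (by positivity)]

/-- The factor `2` is the absolute determinant of `(m, r) ↦ (m + r, m - r)`. -/
theorem lintegral_eq_lintegral_add_sub {f : (Fin 2 → ℝ) → ℝ≥0∞} (hf : Measurable f) :
    ∫⁻ c, f c = 2 * ∫⁻ m : ℝ, ∫⁻ r : ℝ, f ![m + r, m - r] := by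
  have hdet : Matrix.det !![(1 : ℝ), 1; 1, -1] ≠ 0 := by norm_num [Matrix.det_fin_two]
  have h := Real.map_matrix_volume_pi_eq_smul_volume_pi hdet
  have hM : Measurable (Matrix.toLin' !![(1 : ℝ), 1; 1, -1]) :=
    (LinearMap.continuous_of_finiteDimensional _).measurable
  have h2 := congrArg (fun μ => ∫⁻ c, f c ∂μ) h
  simp only [lintegral_smul_measure, lintegral_map hf hM, smul_eq_mul] at h2
  have h3 : ∫⁻ c, f c = 2 * ∫⁻ x, f (Matrix.toLin' !![(1 : ℝ), 1; 1, -1] x) := by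
    rw [h2, ← mul_assoc]
    have : |(Matrix.det !![(1 : ℝ), 1; 1, -1])⁻¹| = 1 / 2 := by norm_num [Matrix.det_fin_two]
    rw [this, one_div, ENNReal.ofReal_inv_of_pos (by norm_num), ENNReal.ofReal_ofNat,
      ENNReal.mul_inv_cancel (by norm_num) (by norm_num), one_mul]
  have h4 := (volume_preserving_finTwoArrow ℝ).symm.lintegral_comp (hf.comp hM)
  simp only [Function.comp_apply] at h4
  rw [h3, ← h4, Measure.volume_eq_prod, lintegral_prod]
  · congr 1
    refine lintegral_congr fun m => lintegral_congr fun r => congrArg f ?_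
    ext i
    fin_cases i
    · simp [MeasurableEquiv.finTwoArrow, Matrix.mulVec, dotProduct]
    · simp [MeasurableEquiv.finTwoArrow, Matrix.mulVec, dotProduct, sub_eq_add_neg]
  · exact ((hf.comp hM).comp (MeasurableEquiv.measurable _)).aemeasurable

theorem map_add_sub_norm_gaussian :
    ((gaussianReal 0 (1 / 2)).prod gaussianThree).map (fun p => ![p.1 + ‖p.2‖, p.1 - ‖p.2‖]) =
      ((volume : Measure (Fin 2 → ℝ)).restrict {c | c 1 ≤ c 0}).withDensity
        (fun c => ENNReal.ofReal
          (2 * (1 / (4 * Real.pi) * (c 0 - c 1) ^ 2 *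
            Real.exp (-((c 0 ^ 2 + c 1 ^ 2) / 2))))) := by
  have hS : MeasurableSet {c : Fin 2 → ℝ | c 1 ≤ c 0} :=
    measurableSet_le (measurable_pi_apply 1) (measurable_pi_apply 0)
  have hψ' : Measurable (fun p : ℝ × ℝ => ![p.1 + p.2, p.1 - p.2]) := by
    refine measurable_pi_lambda _ fun i => ?_
    fin_cases i
    · exact measurable_fst.add measurable_snd
    · exact measurable_fst.sub measurable_snd
  have hψ : Measurable (fun p : ℝ × EuclideanSpace ℝ (Fin 3) =>
      ![p.1 + ‖p.2‖, p.1 - ‖p.2‖]) :=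
    hψ'.comp (measurable_fst.prodMk measurable_snd.norm)
  refine Measure.ext_of_lintegral _ fun F hF => ?_
  have hFr : ∀ m : ℝ, Measurable fun r : ℝ => F ![m + r, m - r] := fun m =>
    hF.comp (hψ'.comp measurable_prodMk_left)
  have hFψ : Measurable fun p : ℝ × EuclideanSpace ℝ (Fin 3) => F ![p.1 + ‖p.2‖, p.1 - ‖p.2‖] :=
    hF.comp hψ
  rw [lintegral_map hF hψ, lintegral_prod _ hFψ.aemeasurable,
    gaussianReal_of_var_ne_zero 0 (by norm_num), lintegral_withDensity_eq_lintegral_mul _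
      (measurable_gaussianPDF 0 _) hFψ.lintegral_prod_right',
    lintegral_withDensity_eq_lintegral_mul _ (by fun_prop) hF, ← lintegral_indicator hS,
    lintegral_eq_lintegral_add_sub ((by fun_prop : Measurable _).indicator hS),
    ← lintegral_const_mul' _ _ ENNReal.ofNat_ne_top]
  refine lintegral_congr fun m => ?_
  -- The half-line is closed at `0`, a null change, so that `0 ≤ r` corresponds exactly to the
  -- closed half-plane `c 1 ≤ c 0`.
  have hinner : ∫⁻ v, F ![m + ‖v‖, m - ‖v‖] ∂gaussianThree =
      ∫⁻ r in Set.Ici (0 : ℝ), ENNReal.ofReal (4 * Real.pi * r ^ 2) *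
        (ENNReal.ofReal ((√Real.pi ^ 3)⁻¹ * Real.exp (-r ^ 2)) * F ![m + r, m - r]) := by
    have hFn : Measurable fun v : EuclideanSpace ℝ (Fin 3) => F ![m + ‖v‖, m - ‖v‖] :=
      (hFr m).comp measurable_norm
    rw [gaussianThree, lintegral_withDensity_eq_lintegral_mul _ (by fun_prop) hFn, setLIntegral_congr Ioi_ae_eq_Ici.symm]
    exact lintegral_fun_norm_euclideanSpace_three
      (f := fun r => ENNReal.ofReal ((√Real.pi ^ 3)⁻¹ * Real.exp (-r ^ 2)) * F ![m + r, m - r])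
      ((by fun_prop : Measurable fun r : ℝ =>
        ENNReal.ofReal ((√Real.pi ^ 3)⁻¹ * Real.exp (-r ^ 2))).mul (hFr m))
  rw [Pi.mul_apply, hinner, gaussianPDF, ← lintegral_const_mul' _ _ ENNReal.ofReal_ne_top,
    ← lintegral_const_mul' _ _ ENNReal.ofNat_ne_top, ← lintegral_indicator measurableSet_Ici]
  refine lintegral_congr fun r => ?_
  by_cases hr : 0 ≤ r
  · have hmem : ![m + r, m - r] ∈ {c : Fin 2 → ℝ | c 1 ≤ c 0} := by
      simp only [Set.mem_ofPred_eq, Matrix.cons_val_zero, Matrix.cons_val_one]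
      linarith
    rw [Set.indicator_of_mem (Set.mem_Ici.2 hr), Set.indicator_of_mem hmem, Pi.mul_apply,
      ← mul_assoc (ENNReal.ofReal _), ← mul_assoc, ← mul_assoc,
      ← ENNReal.ofReal_mul (gaussianPDFReal_nonneg _ _ _),
      ← ENNReal.ofReal_mul (mul_nonneg (gaussianPDFReal_nonneg _ _ _) (by positivity)),
      ← ENNReal.ofReal_ofNat 2, ← ENNReal.ofReal_mul (by norm_num)]
    -- Both sides equal `(4/π) r² e^(-m²-r²)`: the left constant is `π^(-1/2) · 4π · π^(-3/2)`, the
    -- right one is `2 · 2 · (1/(4π))` with `(c 0 - c 1)² = 4r²`.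
    congr 2
    have h1 : gaussianPDFReal 0 (1 / 2) m = (√Real.pi)⁻¹ * Real.exp (-m ^ 2) := by
      rw [gaussianPDFReal]
      congr 3
      · push_cast; ring
      · push_cast; ring
    have h2 : Real.exp (-((((m + r) ^ 2 + (m - r) ^ 2)) / 2)) =
        Real.exp (-m ^ 2) * Real.exp (-r ^ 2) := by
      rw [← Real.exp_add]; ring_nf
    simp only [Matrix.cons_val_zero, Matrix.cons_val_one]
    rw [h1, h2]
    have h3 : √Real.pi ^ 4 = Real.pi ^ 2 := by
      rw [show 4 = 2 * 2 from rfl, pow_mul, Real.sq_sqrt Real.pi_pos.le]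
    have h4 : (√Real.pi)⁻¹ * (√Real.pi ^ 3)⁻¹ = (Real.pi ^ 2)⁻¹ := by
      rw [← mul_inv, ← h3]; ring_nf
    have h5 : Real.pi * (Real.pi ^ 2)⁻¹ = Real.pi⁻¹ := by
      field_simp
    rw [one_div, mul_inv]
    linear_combination (4 * Real.pi * r ^ 2 * Real.exp (-m ^ 2) * Real.exp (-r ^ 2)) * h4 +
      (4 * r ^ 2 * Real.exp (-m ^ 2) * Real.exp (-r ^ 2)) * h5
  · have hmem : ![m + r, m - r] ∉ {c : Fin 2 → ℝ | c 1 ≤ c 0} := by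
      simp only [Set.mem_ofPred_eq, Matrix.cons_val_zero, Matrix.cons_val_one]
      linarith
    rw [Set.indicator_of_notMem (by simpa using hr), Set.indicator_of_notMem hmem, mul_zero]

/-! ### Symmetrization over orderings. -/

/-- Symmetrizing over the two orderings a measure with a swap-invariant density, cut off to the
ordered half-plane, gives back the full density. -/
theorem sum_perm_map_restrict_withDensity {p : (Fin 2 → ℝ) → ℝ≥0∞} (hp : Measurable p)
    (hswap : ∀ c, p (fun i => c (Equiv.swap 0 1 i)) = p c) (hdiag : ∀ c, c 0 = c 1 → p c = 0) :
    ∑ σ : Equiv.Perm (Fin 2), (((volume : Measure (Fin 2 → ℝ)).restrict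
        {c | c 1 ≤ c 0}).withDensity p).map (fun c i => c (σ i)) =
      (volume : Measure (Fin 2 → ℝ)).withDensity p := by
  have hS : MeasurableSet {c : Fin 2 → ℝ | c 1 ≤ c 0} :=
    measurableSet_le (measurable_pi_apply 1) (measurable_pi_apply 0)
  have huniv : (Finset.univ : Finset (Equiv.Perm (Fin 2))) = {1, Equiv.swap 0 1} := by decide
  have hperm : ∀ σ : Equiv.Perm (Fin 2), Measurable fun (c : Fin 2 → ℝ) i => c (σ i) := fun σ =>
    measurable_pi_lambda _ fun i => measurable_pi_apply (σ i)
  refine Measure.ext_of_lintegral _ fun F hF => ?_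
  have hterm : ∀ σ : Equiv.Perm (Fin 2), ∫⁻ c, F c ∂((((volume : Measure (Fin 2 → ℝ)).restrict
        {c | c 1 ≤ c 0}).withDensity p).map (fun c i => c (σ i))) =
      ∫⁻ c, {c : Fin 2 → ℝ | c 1 ≤ c 0}.indicator (fun c => p c * F fun i => c (σ i)) c := by
    intro σ
    have hFσ : Measurable fun c : Fin 2 → ℝ => F fun i => c (σ i) := hF.comp (hperm σ)
    rw [lintegral_map hF (hperm σ), lintegral_withDensity_eq_lintegral_mul _ hp hFσ, lintegral_indicator hS]
    rfl
  have hmeas : ∀ σ : Equiv.Perm (Fin 2), Measurable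
      ({c : Fin 2 → ℝ | c 1 ≤ c 0}.indicator (fun c => p c * F fun i => c (σ i))) := fun σ =>
    (hp.mul (hF.comp (hperm σ))).indicator hS
  have hpres : MeasurePreserving (fun (c : Fin 2 → ℝ) i => c (Equiv.swap 0 1 i))
      volume volume := by
    convert! volume_measurePreserving_piCongrLeft (fun _ : Fin 2 => ℝ) (Equiv.swap 0 1) using 1
    ext c i
    obtain ⟨j, rfl⟩ := (Equiv.swap (0 : Fin 2) 1).surjective i
    rw [MeasurableEquiv.coe_piCongrLeft, Equiv.piCongrLeft_apply_apply, Equiv.swap_apply_self]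
  -- Substituting `c ↦ c ∘ swap` in the second term turns its integrand into `p c * F c` on the
  -- opposite half-plane, so the two terms together cover the plane.
  rw [huniv, Finset.sum_pair (by decide), lintegral_add_measure, hterm, hterm,
    ← hpres.lintegral_comp (hmeas (Equiv.swap 0 1)), ← lintegral_add_left (hmeas 1),
    lintegral_withDensity_eq_lintegral_mul _ hp hF]
  refine lintegral_congr fun c => ?_
  simp only [Set.indicator_apply, Set.mem_ofPred_eq, hswap, Equiv.swap_apply_left,
    Equiv.swap_apply_right, Equiv.swap_apply_self, Equiv.Perm.one_apply, Pi.mul_apply]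
  rcases lt_trichotomy (c 0) (c 1) with h | h | h
  · rw [if_neg h.not_ge, if_pos h.le, zero_add]
  -- The diagonal belongs to both half-planes; the double count vanishes because `p` is zero there.
  · simp [hdiag c h]
  · rw [if_pos h.le, if_neg h.not_ge, add_zero]

/-! ### The eigenvalue laws of `A + B`. -/

theorem hasLaw_orderedEigenvalues_add {Ω : Type*} [MeasurableSpace Ω] {P : Measure Ω}
    [IsProbabilityMeasure P] {A B : Ω → Matrix (Fin 2) (Fin 2) ℂ} (hA : HasLaw A (gue 2) P)
    (hB : HasLaw B (gue 2) P) (hAB : IndepFun A B P) :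
    HasLaw (fun ω => orderedEigenvalues (A ω + B ω))
      (((volume : Measure (Fin 2 → ℝ)).restrict {c | c 1 ≤ c 0}).withDensity
        (fun c => ENNReal.ofReal
          (2 * (1 / (4 * Real.pi) * (c 0 - c 1) ^ 2 *
            Real.exp (-((c 0 ^ 2 + c 1 ^ 2) / 2)))))) P := by
  have hherm : ∀ {X : Ω → Matrix (Fin 2) (Fin 2) ℂ}, HasLaw X (gue 2) P →
      ∀ᵐ ω ∂P, (X ω).IsHermitian := fun hX =>
    ae_of_ae_map hX.aemeasurable (hX.map_eq ▸ isHermitian_ae_gue 2)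
  have hψ : Measurable (fun p : ℝ × EuclideanSpace ℝ (Fin 3) =>
      ![p.1 + ‖p.2‖, p.1 - ‖p.2‖]) := by
    refine measurable_pi_lambda _ fun i => ?_
    fin_cases i
    · exact measurable_fst.add measurable_snd.norm
    · exact measurable_fst.sub measurable_snd.norm
  have hcoord : AEMeasurable
      (fun ω => (halfTrace (A ω + B ω), blochVector (A ω + B ω))) P := by
    have : AEMeasurable (fun ω => A ω + B ω) P := by
      refine aemeasurable_pi_lambda (X := fun _ : Fin 2 => Fin 2 → ℂ) _ fun i =>
        aemeasurable_pi_lambda _ fun j => ?_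
      exact ((measurable_matrix_entry i j).comp_aemeasurable hA.aemeasurable).add
        ((measurable_matrix_entry i j).comp_aemeasurable hB.aemeasurable)
    exact (measurable_halfTrace.prodMk measurable_blochVector).comp_aemeasurable this
  -- `A` and `B` are Hermitian only almost surely. This a.e. identity also supplies the a.e.
  -- measurability of the ordered eigenvalues.
  have hae : (fun ω => orderedEigenvalues (A ω + B ω)) =ᵐ[P]
      (fun p : ℝ × EuclideanSpace ℝ (Fin 3) => ![p.1 + ‖p.2‖, p.1 - ‖p.2‖]) ∘
        fun ω => (halfTrace (A ω + B ω), blochVector (A ω + B ω)) := by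
    filter_upwards [hherm hA, hherm hB] with ω h1 h2
    exact orderedEigenvalues_eq_of_isHermitian (h1.add h2)
  refine ⟨(hψ.comp_aemeasurable hcoord).congr hae.symm, ?_⟩
  rw [Measure.map_congr hae, ← AEMeasurable.map_map_of_aemeasurable hψ.aemeasurable hcoord,
    map_pauliCoord_add hA hB hAB, map_add_sub_norm_gaussian]

theorem mainTheorem8 {Ω : Type*} [MeasurableSpace Ω] (P : Measure Ω) [IsProbabilityMeasure P]
    (A B : Ω → Matrix (Fin 2) (Fin 2) ℂ) (hA : HasLaw A (gue 2) P) (hB : HasLaw B (gue 2) P)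
    (hAB : IndepFun A B P) :
    eigenvalueLaw P (fun ω => A ω + B ω) =
        (volume : Measure (Fin 2 → ℝ)).withDensity (fun c => ENNReal.ofReal
          (1 / (4 * Real.pi) * (c 0 - c 1) ^ 2 * Real.exp (-((c 0 ^ 2 + c 1 ^ 2) / 2)))) ∧
      HasLaw (fun ω => orderedEigenvalues (A ω + B ω))
        (((volume : Measure (Fin 2 → ℝ)).restrict {c | c 1 ≤ c 0}).withDensity
          (fun c => ENNReal.ofReal
            (2 * (1 / (4 * Real.pi) * (c 0 - c 1) ^ 2 *
              Real.exp (-((c 0 ^ 2 + c 1 ^ 2) / 2)))))) P := by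
  have h := hasLaw_orderedEigenvalues_add hA hB hAB
  refine ⟨?_, h⟩
  have hmap : ∀ σ : Equiv.Perm (Fin 2),
      P.map (fun ω i => orderedEigenvalues (A ω + B ω) (σ i)) =
        (P.map fun ω => orderedEigenvalues (A ω + B ω)).map (fun c i => c (σ i)) := fun σ =>
    (AEMeasurable.map_map_of_aemeasurable (measurable_pi_lambda _ fun i =>
      measurable_pi_apply (σ i)).aemeasurable h.aemeasurable).symm
  simp_rw [eigenvalueLaw, hmap, h.map_eq]
  -- The sum over orderings has the ordered density extended to the whole plane; the prefactor
  -- `1/2!` then cancels its factor `2`.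
  rw [sum_perm_map_restrict_withDensity (by fun_prop), ← withDensity_smul _ (by fun_prop)]
  · congr 1
    ext c
    rw [Pi.smul_apply, smul_eq_mul, ENNReal.ofReal_mul two_pos.le, ENNReal.ofReal_ofNat,
      Nat.factorial_two, Nat.cast_ofNat, ← mul_assoc,
      ENNReal.inv_mul_cancel two_ne_zero ENNReal.ofNat_ne_top, one_mul]
  · intro c
    beta_reduce
    rw [Equiv.swap_apply_left, Equiv.swap_apply_right, add_comm (c 1 ^ 2), sub_sq_comm]
  · intro c hc
    simp [hc]
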